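/- **Theorem 1.** Let $n \ge 0$ and let $\Omega \subset \mathbb{C}^n$ be an open set. An open set $\Omega\subset\mathbb{C}^n$ is called *pseudoconvex* if it satisfies the Kontinuitätssatz: for every family $\{d_\alpha\}_{\alpha\in A}$ of analytic discs in $\Omega$ (maps $d_\alpha\colon\overline{\mathbb{D}}\to\Omega$ of the closed unit disc that are continuous on $\overline{\mathbb{D}}$ and holomorphic on $\mathbb{D}$) such that $\bigcup_{\alpha} d_\alpha(\partial\mathbb{D})$ is contained in a compact subset of $\Omega$, the union $\bigcup_{\alpha} d_\alpha(\overline{\mathbb{D}})$ is contained in a compact subset of $\Omega$. For $a,b,c\in\mathbb{C}^n$ with $b,c$ linearly independent over $\mathbb{C}$, let $\phi(w_1,w_2)=a+bw_1+cw_2$ parametrize the 2-dimensional complex affine subspace $h=h(a,b,c)=\phi(\mathbb{C}^2)$, and let $\Omega_h=\phi^{-1}(\Omega)\subset\mathbb{C}^2$ be the slice of $\Omega$ by $h$, seen as a set in $\mathbb{C}^2$. Then $\Omega$ is pseudoconvex if and only if, for every such 2-dimensional complex affine subspace $h=h(a,b,c)$, the slice $\Omega_h\subset\mathbb{C}^2$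 is pseudoconvex. -/

import Mathlib

/-- `d` restricted to the closed unit disc of `ℂ` is a (closed) analytic disc in `Ω ⊆ ℂⁿ`: it is
continuous on the closed disc, holomorphic on the open disc, and maps the closed disc into `Ω`. -/
def IsAnalyticDisc {n : ℕ} (Ω : Set (EuclideanSpace ℂ (Fin n)))
    (d : ℂ → EuclideanSpace ℂ (Fin n)) : Prop :=
  ContinuousOn d (Metric.closedBall 0 1) ∧
    DifferentiableOn ℂ d (Metric.ball 0 1) ∧
    Set.MapsTo d (Metric.closedBall 0 1) Ω

/-- An open set `Ω ⊆ ℂⁿ` is pseudoconvex if it satisfies the Kontinuitätssatz: for every family of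
analytic discs in `Ω`, if the images of the boundaries of the discs all lie in a single compact
subset of `Ω`, then the images of the whole discs all lie in a single compact subset of `Ω`. -/
def IsPseudoconvex {n : ℕ} (Ω : Set (EuclideanSpace ℂ (Fin n))) : Prop :=
  IsOpen Ω ∧
    ∀ 𝒟 : Set (ℂ → EuclideanSpace ℂ (Fin n)), (∀ d ∈ 𝒟, IsAnalyticDisc Ω d) →
      (∃ K ⊆ Ω, IsCompact K ∧ ∀ d ∈ 𝒟, d '' Metric.sphere 0 1 ⊆ K) →
      ∃ L ⊆ Ω, IsCompact L ∧ ∀ d ∈ 𝒟, d '' Metric.closedBall 0 1 ⊆ L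

/-- The parametrization `φ(w₁, w₂) = a + b w₁ + c w₂` of the affine subspace `h(a, b, c)`. -/
def planeParam {n : ℕ} (a b c : EuclideanSpace ℂ (Fin n)) (w : EuclideanSpace ℂ (Fin 2)) :
    EuclideanSpace ℂ (Fin n) :=
  a + w 0 • b + w 1 • c

/-- The slice `Ω_h = φ⁻¹(Ω)` of `Ω` by `h = h(a, b, c)`, seen as a subset of `ℂ²`. -/
def slice {n : ℕ} (a b c : EuclideanSpace ℂ (Fin n)) (Ω : Set (EuclideanSpace ℂ (Fin n))) :
    Set (EuclideanSpace ℂ (Fin 2)) :=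
  planeParam a b c ⁻¹' Ω

open Filter Topology Metric

/-! Pseudoconvexity passes to slices because planes are properly embedded. For the converse, the
distance `δ` to `Ωᶜ` obeys a minimum principle along analytic discs; with the maximum principle for
`‖d‖`, this confines the discs to a compact subset of `Ω`.

If the minimum principle failed for `n ≥ 2`, then `δ ∘ d - ε‖ζ‖²` would have an interior minimum
`ζ₀`, near which `δ ∘ d` exceeds the modulus of an affine function by a multiple of `‖η‖²`. Let `v`
point from `d ζ₀` to a nearest point `p` of `Ωᶜ`. In a plane through `d ζ₀` containing `v` and the
tangent of `d`, a quadratic approximation of `d`, shifted along `v`, gives discs in `Ω` whose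
centres tend to `p` while their boundaries stay in a compact subset of `Ω`. The Kontinuitätssatz in
that plane forces `p ∈ Ω`, a contradiction (`add_smul_mem_of_eventually_ball_subset`). -/

theorem norm_ofReal_add_le {r : ℝ} (hr : 0 < r) (w : ℂ) :
    ‖(r : ℂ) + w‖ ≤ r + w.re + ‖w‖ ^ 2 / (2 * r) := by
  have h1 : ‖(r : ℂ) + w‖ ^ 2 = (r + w.re) ^ 2 + w.im ^ 2 := by
    rw [← Complex.normSq_eq_norm_sq, Complex.normSq_apply]
    simp
    ring
  have h2 : ‖w‖ ^ 2 = w.re ^ 2 + w.im ^ 2 := by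
    rw [← Complex.normSq_eq_norm_sq, Complex.normSq_apply]
    ring
  have hx : 0 ≤ r + w.re + ‖w‖ ^ 2 / (2 * r) := by
    have : r + w.re + ‖w‖ ^ 2 / (2 * r) = (r ^ 2 + (r + w.re) ^ 2 + w.im ^ 2) / (2 * r) := by
      rw [h2]
      field_simp
      ring
    rw [this]
    positivity
  refine le_of_sq_le_sq ?_ hx
  have : (r + w.re + ‖w‖ ^ 2 / (2 * r)) ^ 2 =
      (r + w.re) ^ 2 + w.im ^ 2 + (w.re + ‖w‖ ^ 2 / (2 * r)) ^ 2 := by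
    have h3 : ‖w‖ ^ 2 / (2 * r) * (2 * r) = w.re ^ 2 + w.im ^ 2 := by
      rw [h2]
      field_simp
    linear_combination h3
  rw [h1, this]
  nlinarith [sq_nonneg (w.re + ‖w‖ ^ 2 / (2 * r))]

/-! ### Slices of pseudoconvex sets -/

theorem continuous_planeParam {n : ℕ} (a b c : EuclideanSpace ℂ (Fin n)) :
    Continuous (planeParam a b c) := by
  unfold planeParam
  fun_prop

theorem differentiable_planeParam {n : ℕ} (a b c : EuclideanSpace ℂ (Fin n)) :
    Differentiable ℂ (planeParam a b c) := by
  unfold planeParam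
  fun_prop

/-- Gives properness: compact subsets of `Ω` pull back to compact subsets of the slice. -/
theorem isClosedEmbedding_planeParam {n : ℕ} (a : EuclideanSpace ℂ (Fin n))
    {b c : EuclideanSpace ℂ (Fin n)} (h : LinearIndependent ℂ ![b, c]) :
    IsClosedEmbedding (planeParam a b c) := by
  let l : EuclideanSpace ℂ (Fin 2) →ₗ[ℂ] EuclideanSpace ℂ (Fin n) :=
    { toFun := fun w => w 0 • b + w 1 • c
      map_add' := fun x y => by simp only [PiLp.add_apply]; module
      map_smul' := fun t x => by
        simp only [PiLp.smul_apply, smul_eq_mul, RingHom.id_apply]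
        module }
  have hl : LinearMap.ker l = ⊥ := by
    rw [LinearMap.ker_eq_bot']
    intro w hw
    obtain ⟨h0, h1⟩ := LinearIndependent.pair_iff.1 h (w 0) (w 1) hw
    ext i
    fin_cases i
    · exact h0
    · exact h1
  have he : planeParam a b c = (Homeomorph.addLeft a) ∘ l := by
    funext w
    simp [planeParam, l, add_assoc]
  rw [he]
  exact (Homeomorph.addLeft a).isClosedEmbedding.comp
    (LinearMap.isClosedEmbedding_of_injective hl)

theorem IsPseudoconvex.slice {n : ℕ} {Ω : Set (EuclideanSpace ℂ (Fin n))} (hΩ : IsPseudoconvex Ω)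
    (a : EuclideanSpace ℂ (Fin n)) {b c : EuclideanSpace ℂ (Fin n)}
    (h : LinearIndependent ℂ ![b, c]) : IsPseudoconvex (slice a b c Ω) := by
  have hφ := continuous_planeParam a b c
  refine ⟨hΩ.1.preimage hφ, ?_⟩
  rintro 𝒟 h𝒟 ⟨K, hKΩ, hK, h𝒟K⟩
  obtain ⟨L, hLΩ, hL, h𝒟L⟩ := hΩ.2 ((fun d => planeParam a b c ∘ d) '' 𝒟)
    (by
      rintro _ ⟨d, hd, rfl⟩
      obtain ⟨h1, h2, h3⟩ := h𝒟 d hd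
      exact ⟨hφ.comp_continuousOn h1, (differentiable_planeParam a b c).comp_differentiableOn h2,
        fun ζ hζ => h3 hζ⟩)
    ⟨planeParam a b c '' K, Set.image_subset_iff.2 hKΩ, hK.image hφ, by
      rintro _ ⟨d, hd, rfl⟩
      change (planeParam a b c ∘ d) '' _ ⊆ _
      rw [Set.image_comp]
      exact Set.image_mono (h𝒟K d hd)⟩
  refine ⟨planeParam a b c ⁻¹' L, Set.preimage_mono hLΩ,
    (isClosedEmbedding_planeParam a h).isCompact_preimage hL, fun d hd => ?_⟩
  rw [← Set.image_subset_iff, ← Set.image_comp]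
  exact h𝒟L _ ⟨d, hd, rfl⟩

/-! ### Planar discs approaching a boundary point -/

/-- A vector `b` lies in a complex plane containing a given nonzero vector `v`. -/
theorem exists_linearIndependent_pair_combination {n : ℕ} (hn : 2 ≤ n)
    (b : EuclideanSpace ℂ (Fin n)) {v : EuclideanSpace ℂ (Fin n)} (hv : v ≠ 0) :
    ∃ b' : EuclideanSpace ℂ (Fin n), LinearIndependent ℂ ![b', v] ∧
      ∃ α β : ℂ, b = α • b' + β • v := by
  by_cases h : ∃ β : ℂ, β • v = b
  · obtain ⟨β, rfl⟩ := h
    obtain ⟨b', hb'⟩ := exists_linearIndependent_pair_of_one_lt_finrank (R := ℂ)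
      (by rw [finrank_euclideanSpace_fin]; lia) hv
    exact ⟨b', LinearIndependent.pair_symm_iff.1 hb', 0, β, by simp⟩
  · refine ⟨b, LinearIndependent.pair_symm_iff.1 ?_, 1, 0, by simp⟩
    exact (LinearIndependent.pair_iff' hv).2 fun β hβ => h ⟨β, hβ⟩

/-- Let all planar slices of `Ω` be pseudoconvex. If `Ω` contains the balls about the points
`d (ζ₀ + η)` of a holomorphic curve whose radii exceed the modulus `|r + c η|` of an affine
function by `ε |η| ^ 2`, then `Ω` contains the sphere of radius `r` about `d ζ₀`. -/
theorem add_smul_mem_of_eventually_ball_subset {n : ℕ} (hn : 2 ≤ n)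
    {Ω : Set (EuclideanSpace ℂ (Fin n))}
    (hs : ∀ a b c : EuclideanSpace ℂ (Fin n), LinearIndependent ℂ ![b, c] →
      IsPseudoconvex (slice a b c Ω))
    {d : ℂ → EuclideanSpace ℂ (Fin n)} {ζ₀ : ℂ} (hd : ∀ᶠ ζ in 𝓝 ζ₀, DifferentiableAt ℂ d ζ)
    {r ε : ℝ} (hr : 0 < r) (hε : 0 < ε) (c : ℂ)
    (hball : ∀ᶠ η in 𝓝 (0 : ℂ), ball (d (ζ₀ + η)) (‖(r : ℂ) + c * η‖ + ε * ‖η‖ ^ 2) ⊆ Ω)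
    {v : EuclideanSpace ℂ (Fin n)} (hv : ‖v‖ = 1) : d ζ₀ + (r : ℂ) • v ∈ Ω := by
  obtain ⟨U, hU, hdU⟩ : ∃ U ∈ 𝓝 ζ₀, DifferentiableOn ℂ d U :=
    ⟨_, hd, fun ζ hζ => DifferentiableAt.differentiableWithinAt hζ⟩
  set d₁ := dslope d ζ₀ with hd₁
  set d₂ := dslope d₁ ζ₀ with hd₂
  have hd₂U : DifferentiableOn ℂ d₂ U :=
    (Complex.differentiableOn_dslope hU).2 ((Complex.differentiableOn_dslope hU).2 hdU)
  have hd₂c : ContinuousAt d₂ ζ₀ := (hd₂U.continuousOn.continuousAt hU)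
  set b := d₁ ζ₀ with hb
  set a := d₂ ζ₀ with ha
  have hexp : ∀ η : ℂ, d (ζ₀ + η) = d ζ₀ + η • b + η ^ 2 • d₂ (ζ₀ + η) := by
    intro η
    have e1 := sub_smul_dslope d ζ₀ (ζ₀ + η)
    have e2 := sub_smul_dslope d₁ ζ₀ (ζ₀ + η)
    rw [add_sub_cancel_left, ← hd₁] at e1
    rw [add_sub_cancel_left, ← hd₂, ← hb] at e2
    rw [pow_two, mul_smul, e2, smul_sub, e1]
    abel
  -- Only the `v`-component of the second-order coefficient `a` fits in the plane. The rest is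
  -- orthogonal to `v`, so by Pythagoras it adds only `O(‖η‖⁴)` to the squared norm.
  set μ : ℂ := inner ℂ v a with hμ
  have horth : inner ℂ v (a - μ • v) = 0 := by
    rw [inner_sub_right, inner_smul_right, inner_self_eq_norm_sq_to_K, hv, ← hμ]
    simp
  set A : ℝ := ‖a - μ • v‖ with hA
  have hsmall : ∀ᶠ η in 𝓝 (0 : ℂ), r / 2 < ‖(r : ℂ) + c * η‖ ∧ ‖η‖ ^ 2 * A ^ 2 < ε * r / 2 ∧
      ‖d₂ (ζ₀ + η) - a‖ < ε / 2 := by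
    refine Eventually.and ?_ (Eventually.and ?_ ?_)
    · have : Continuous fun η : ℂ => ‖(r : ℂ) + c * η‖ := by fun_prop
      refine (this.tendsto 0).eventually_const_lt ?_
      simp [abs_of_pos hr, hr]
    · have : Continuous fun η : ℂ => ‖η‖ ^ 2 * A ^ 2 := by fun_prop
      refine (this.tendsto 0).eventually_lt_const ?_
      simpa using mul_pos hε hr
    · have h0 : Tendsto (fun η : ℂ => ‖d₂ (ζ₀ + η) - a‖) (𝓝 0) (𝓝 0) := by
        have h1 : Tendsto (fun η : ℂ => ζ₀ + η) (𝓝 0) (𝓝 ζ₀) := by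
          simpa using (continuous_const_add ζ₀).tendsto (0 : ℂ)
        exact tendsto_iff_norm_sub_tendsto_zero.1 (hd₂c.tendsto.comp h1)
      exact h0.eventually_lt_const (by positivity)
  obtain ⟨ρ, hρ, hρball⟩ := nhds_basis_closedBall.mem_iff.1 (hball.and hsmall)
  -- The tangent `b` may vanish or be parallel to `v`, so it cannot itself serve as a basis vector.
  obtain ⟨b', hli, α, β, hbb'⟩ := exists_linearIndependent_pair_combination hn b
    (v := v) (by rintro rfl; simp at hv)
  -- In the ambient space this is `d ζ₀ + η b + η² μ v + (1 - s)(r + c η) v`.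
  let q : ℝ × ℂ → EuclideanSpace ℂ (Fin 2) := fun x =>
    !₂[α * x.2, β * x.2 + (1 - x.1) * (r + c * x.2) + x.2 ^ 2 * μ]
  have hq : Continuous q := by
    refine (PiLp.continuous_toLp 2 _).comp (continuous_pi fun i => ?_)
    fin_cases i
    · change Continuous fun x : ℝ × ℂ => α * x.2
      fun_prop
    · change Continuous fun x : ℝ × ℂ => β * x.2 + (1 - x.1) * (r + c * x.2) + x.2 ^ 2 * μ
      fun_prop
  have hqdiff : ∀ s : ℝ, Differentiable ℂ fun ζ => q (s, ζ) := by
    intro s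
    rw [differentiable_euclidean]
    intro i
    fin_cases i
    · change Differentiable ℂ fun x : ℂ => α * x
      fun_prop
    · change Differentiable ℂ fun x : ℂ => β * x + (1 - s) * (r + c * x) + x ^ 2 * μ
      fun_prop
  have hqΩ : ∀ s ∈ Set.Icc (0 : ℝ) 1, ∀ η ∈ closedBall (0 : ℂ) ρ, (0 < s ∨ η ≠ 0) →
      q (s, η) ∈ slice (d ζ₀) b' v Ω := by
    intro s hs' η hη hne
    obtain ⟨hΩ', h1, h2, h3⟩ := hρball hη
    refine hΩ' ?_
    rw [mem_ball, dist_eq_norm]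
    have hdiff : planeParam (d ζ₀) b' v (q (s, η)) - d (ζ₀ + η) =
        (((1 - s : ℝ) : ℂ) * (r + c * η)) • v - η ^ 2 • (a - μ • v)
          - η ^ 2 • (d₂ (ζ₀ + η) - a) := by
      rw [hexp, hbb']
      simp only [planeParam, q, Matrix.cons_val_zero, Matrix.cons_val_one,
        Complex.ofReal_sub, Complex.ofReal_one]
      module
    set X := ‖(r : ℂ) + c * η‖
    have hX : 0 < X := by linarith
    have hpyth : ‖(((1 - s : ℝ) : ℂ) * (r + c * η)) • v - η ^ 2 • (a - μ • v)‖ ^ 2 =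
        ((1 - s) * X) ^ 2 + (‖η‖ ^ 2 * A) ^ 2 := by
      rw [norm_sub_sq (𝕜 := ℂ), inner_smul_left, inner_smul_right, horth, mul_zero, mul_zero,
        map_zero, norm_smul, norm_smul, norm_mul, Complex.norm_real, hv, Real.norm_eq_abs,
        abs_of_nonneg (by linarith [hs'.2]), norm_pow]
      ring
    have hN : ‖(((1 - s : ℝ) : ℂ) * (r + c * η)) • v - η ^ 2 • (a - μ • v)‖ ≤
        X + ε / 2 * ‖η‖ ^ 2 := by
      refine le_of_sq_le_sq ?_ (by positivity)
      rw [hpyth]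
      have e1 : ((1 - s) * X) ^ 2 ≤ X ^ 2 :=
        pow_le_pow_left₀ (mul_nonneg (by linarith [hs'.2]) hX.le)
          (by nlinarith [hs'.1]) 2
      have e2 : (‖η‖ ^ 2 * A) ^ 2 ≤ ‖η‖ ^ 2 * (ε * X) := by
        rw [show (‖η‖ ^ 2 * A) ^ 2 = ‖η‖ ^ 2 * (‖η‖ ^ 2 * A ^ 2) by ring]
        refine mul_le_mul_of_nonneg_left ?_ (by positivity)
        nlinarith
      nlinarith [sq_nonneg (ε / 2 * ‖η‖ ^ 2)]
    rw [hdiff]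
    refine (norm_sub_le _ _).trans_lt ?_
    rw [norm_smul (η ^ 2) (d₂ (ζ₀ + η) - a), norm_pow]
    by_cases hη0 : η = 0
    · have hs0 : 0 < s := hne.resolve_right (not_not.2 hη0)
      have e : ‖(((1 - s : ℝ) : ℂ) * (r + c * η)) • v - η ^ 2 • (a - μ • v)‖ < X := by
        refine lt_of_pow_lt_pow_left₀ 2 hX.le ?_
        rw [hpyth, hη0]
        have : ((1 - s) * X) ^ 2 < X ^ 2 :=
          pow_lt_pow_left₀ (by nlinarith) (mul_nonneg (by linarith [hs'.2]) hX.le) two_ne_zero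
        simpa using this
      have : ‖η‖ = 0 := by rw [hη0, norm_zero]
      rw [this]
      simpa using e
    · have hη1 : 0 < ‖η‖ ^ 2 := by positivity
      nlinarith
  -- At `s = 0` only the centre is not yet known to lie in `Ω`. The discs therefore use `s > 0`,
  -- while their boundaries stay compact with `s = 0` included.
  obtain ⟨L, hLΩ, hL, h𝒟L⟩ := (hs (d ζ₀) b' v hli).2
    {f | ∃ s ∈ Set.Ioc (0 : ℝ) 1, f = fun ζ => q (s, ρ * ζ)}
    (by
      rintro _ ⟨s, hs', rfl⟩
      have hdf : Differentiable ℂ fun ζ : ℂ => q (s, ρ * ζ) :=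
        (hqdiff s).comp (by fun_prop : Differentiable ℂ fun ζ : ℂ => (ρ : ℂ) * ζ)
      refine ⟨hdf.continuous.continuousOn, hdf.differentiableOn, fun ζ hζ => ?_⟩
      refine hqΩ s ⟨hs'.1.le, hs'.2⟩ _ ?_ (Or.inl hs'.1)
      rw [mem_closedBall_zero_iff] at hζ ⊢
      rw [norm_mul, Complex.norm_real, Real.norm_eq_abs, abs_of_pos hρ]
      nlinarith)
    ⟨q '' (Set.Icc (0 : ℝ) 1 ×ˢ sphere (0 : ℂ) ρ), by
      rintro _ ⟨⟨s, η⟩, ⟨hs', hη⟩, rfl⟩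
      exact hqΩ s hs' η (sphere_subset_closedBall hη)
        (Or.inr (ne_of_mem_sphere hη hρ.ne')),
      (isCompact_Icc.prod (isCompact_sphere _ _)).image hq, by
      rintro _ ⟨s, hs', rfl⟩ _ ⟨ζ, hζ, rfl⟩
      refine ⟨(s, ρ * ζ), ⟨⟨hs'.1.le, hs'.2⟩, ?_⟩, rfl⟩
      rw [mem_sphere_zero_iff_norm] at hζ ⊢
      rw [norm_mul, Complex.norm_real, Real.norm_eq_abs, abs_of_pos hρ, hζ, mul_one]⟩
  have hmem : q (0, 0) ∈ L := by
    have ht : Tendsto (fun s : ℝ => q (s, 0)) (𝓝[>] 0) (𝓝 (q (0, 0))) :=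
      ((hq.comp (by fun_prop : Continuous fun s : ℝ => (s, (0 : ℂ)))).tendsto 0).mono_left
        nhdsWithin_le_nhds
    refine hL.isClosed.mem_of_tendsto ht ?_
    filter_upwards [Ioc_mem_nhdsGT (zero_lt_one' ℝ)] with s hs'
    refine h𝒟L _ ⟨s, hs', rfl⟩ ⟨0, by simp, by simp⟩
  have := hLΩ hmem
  simpa [slice, planeParam, q] using this

/-! ### The minimum principle for the boundary distance -/

theorem le_infDist_compl_of_sphere_of_two_le {n : ℕ} (hn : 2 ≤ n)
    {Ω : Set (EuclideanSpace ℂ (Fin n))} (hΩ : IsOpen Ω) (hne : Ωᶜ.Nonempty)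
    (hs : ∀ a b c : EuclideanSpace ℂ (Fin n), LinearIndependent ℂ ![b, c] →
      IsPseudoconvex (slice a b c Ω))
    {d : ℂ → EuclideanSpace ℂ (Fin n)} (hd : IsAnalyticDisc Ω d) {m : ℝ}
    (hm : ∀ ζ ∈ sphere (0 : ℂ) 1, m ≤ infDist (d ζ) Ωᶜ) :
    ∀ ζ ∈ closedBall (0 : ℂ) 1, m ≤ infDist (d ζ) Ωᶜ := by
  intro ζ₁ hζ₁
  by_contra! hlt
  obtain ⟨hdc, hdd, hdΩ⟩ := hd
  have hδc : ContinuousOn (fun ζ => infDist (d ζ) Ωᶜ) (closedBall 0 1) :=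
    (continuous_infDist_pt _).comp_continuousOn hdc
  have hpos : ∀ ζ ∈ closedBall (0 : ℂ) 1, 0 < infDist (d ζ) Ωᶜ := fun ζ hζ =>
    (hΩ.isClosed_compl.notMem_iff_infDist_pos hne).1 (not_not.2 (hdΩ hζ))
  obtain ⟨ζ₂, hζ₂, hmin₂⟩ := (isCompact_closedBall (0 : ℂ) 1).exists_isMinOn ⟨ζ₁, hζ₁⟩ hδc
  -- The first bound keeps the perturbed minimum off the circle. The second, taken at the global
  -- minimum since `ζ₀` depends on `ε`, yields `4ε ≤ r`.
  obtain ⟨ε, hε, hε₁, hε₂⟩ : ∃ ε : ℝ, 0 < ε ∧ infDist (d ζ₁) Ωᶜ + ε < m ∧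
      4 * ε ≤ infDist (d ζ₂) Ωᶜ := by
    have h2 := hpos ζ₂ hζ₂
    refine ⟨min ((m - infDist (d ζ₁) Ωᶜ) / 2) (infDist (d ζ₂) Ωᶜ / 4),
      lt_min (by linarith) (by linarith), ?_, ?_⟩
    · linarith [min_le_left ((m - infDist (d ζ₁) Ωᶜ) / 2) (infDist (d ζ₂) Ωᶜ / 4)]
    · linarith [min_le_right ((m - infDist (d ζ₁) Ωᶜ) / 2) (infDist (d ζ₂) Ωᶜ / 4)]
  obtain ⟨ζ₀, hζ₀, hmin⟩ := (isCompact_closedBall (0 : ℂ) 1).exists_isMinOn ⟨ζ₁, hζ₁⟩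
    (hδc.sub (by fun_prop : ContinuousOn (fun ζ : ℂ => ε * ‖ζ‖ ^ 2) (closedBall 0 1)))
  have hmin' : ∀ ζ ∈ closedBall (0 : ℂ) 1,
      infDist (d ζ₀) Ωᶜ - ε * ‖ζ₀‖ ^ 2 ≤ infDist (d ζ) Ωᶜ - ε * ‖ζ‖ ^ 2 :=
    fun ζ hζ => hmin hζ
  have hζ₀le : ‖ζ₀‖ ≤ 1 := mem_closedBall_zero_iff.1 hζ₀
  have hζ₀lt : ‖ζ₀‖ < 1 := by
    refine lt_of_le_of_ne hζ₀le fun h => ?_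
    have h1 := hm ζ₀ (mem_sphere_zero_iff_norm.2 h)
    have h2 := hmin' ζ₁ hζ₁
    rw [h] at h2
    nlinarith [mul_nonneg hε.le (sq_nonneg ‖ζ₁‖)]
  set r := infDist (d ζ₀) Ωᶜ with hr
  have hr0 : 0 < r := hpos ζ₀ hζ₀
  have hrε : 4 * ε ≤ r := hε₂.trans (hmin₂ hζ₀)
  obtain ⟨p, hp, hpr⟩ := hΩ.isClosed_compl.exists_infDist_eq_dist hne (d ζ₀)
  have hball : ∀ᶠ η in 𝓝 (0 : ℂ), ball (d (ζ₀ + η))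
      (‖(r : ℂ) + 2 * ε * starRingEnd ℂ ζ₀ * η‖ + ε / 2 * ‖η‖ ^ 2) ⊆ Ω := by
    have hin : ∀ᶠ η in 𝓝 (0 : ℂ), ζ₀ + η ∈ ball (0 : ℂ) 1 := by
      refine (continuous_const_add ζ₀).continuousAt.eventually_mem (isOpen_ball.mem_nhds ?_)
      simpa using hζ₀lt
    filter_upwards [hin] with η hη
    refine (ball_subset_ball ?_).trans ball_infDist_compl_subset
    have h1 := hmin' _ (ball_subset_closedBall hη)
    -- Replacing the real affine lower bound by the modulus of a complex affine function costs at
    -- most half of the gain `ε‖η‖²`, because `4ε ≤ r`.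
    have h2 := norm_ofReal_add_le hr0 (2 * ε * starRingEnd ℂ ζ₀ * η)
    have h3 : ‖(2 * ε * starRingEnd ℂ ζ₀ * η : ℂ)‖ ^ 2 / (2 * r) ≤ ε / 2 * ‖η‖ ^ 2 := by
      have e : ‖(2 * ε * starRingEnd ℂ ζ₀ * η : ℂ)‖ = 2 * ε * ‖ζ₀‖ * ‖η‖ := by
        simp [abs_of_pos hε]
      rw [e, div_le_iff₀ (by positivity)]
      have e1 : ‖ζ₀‖ ^ 2 ≤ 1 := pow_le_one₀ (norm_nonneg _) hζ₀le
      have e2 : 0 ≤ ε * ‖η‖ ^ 2 := by positivity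
      calc (2 * ε * ‖ζ₀‖ * ‖η‖) ^ 2 = (ε * ‖η‖ ^ 2) * (4 * ε * ‖ζ₀‖ ^ 2) := by ring
        _ ≤ (ε * ‖η‖ ^ 2) * r :=
          mul_le_mul_of_nonneg_left (by nlinarith) e2
        _ = ε / 2 * ‖η‖ ^ 2 * (2 * r) := by ring
    have h4 : ‖ζ₀ + η‖ ^ 2 = ‖ζ₀‖ ^ 2 + 2 * (starRingEnd ℂ ζ₀ * η).re + ‖η‖ ^ 2 := by
      simp only [← Complex.normSq_eq_norm_sq, Complex.normSq_apply, Complex.add_re,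
        Complex.add_im, Complex.mul_re, Complex.conj_re, Complex.conj_im]
      ring
    have h5 : (2 * ε * starRingEnd ℂ ζ₀ * η : ℂ).re = 2 * ε * (starRingEnd ℂ ζ₀ * η).re := by
      rw [mul_assoc, show (2 * ε : ℂ) = ((2 * ε : ℝ) : ℂ) by push_cast; rfl,
        Complex.re_ofReal_mul]
    rw [h4] at h1
    rw [h5] at h2
    linarith
  have hpd : ‖p - d ζ₀‖ = r := by rw [hr, hpr, dist_comm, dist_eq_norm]
  have hdiff : ∀ᶠ ζ in 𝓝 ζ₀, DifferentiableAt ℂ d ζ := by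
    filter_upwards [isOpen_ball.mem_nhds (mem_ball_zero_iff.2 hζ₀lt)] with ζ hζ
    exact hdd.differentiableAt (isOpen_ball.mem_nhds hζ)
  have hmem := add_smul_mem_of_eventually_ball_subset hn hs hdiff hr0 (half_pos hε) _ hball
    (v := ((r : ℂ)⁻¹) • (p - d ζ₀))
    (by
      rw [norm_smul, hpd, norm_inv, Complex.norm_real, Real.norm_eq_abs, abs_of_pos hr0,
        inv_mul_cancel₀ hr0.ne'])
  rw [smul_inv_smul₀ (Complex.ofReal_ne_zero.2 hr0.ne'), add_sub_cancel] at hmem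
  exact hp hmem

/-- There are no planes here, so slices give nothing. For `n = 1`, the maximum principle applies to
`1 / (d - p)` for each `p ∉ Ω`. -/
theorem le_infDist_compl_of_sphere_of_lt_two {n : ℕ} (hn : n < 2)
    {Ω : Set (EuclideanSpace ℂ (Fin n))} (hne : Ωᶜ.Nonempty)
    {d : ℂ → EuclideanSpace ℂ (Fin n)} (hd : IsAnalyticDisc Ω d) {m : ℝ} (hm0 : 0 < m)
    (hm : ∀ ζ ∈ sphere (0 : ℂ) 1, m ≤ infDist (d ζ) Ωᶜ) :
    ∀ ζ ∈ closedBall (0 : ℂ) 1, m ≤ infDist (d ζ) Ωᶜ := by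
  intro ζ hζ
  obtain ⟨hdc, hdd, hdΩ⟩ := hd
  rw [le_infDist hne]
  intro p hp
  have hdp : ∀ ξ ∈ closedBall (0 : ℂ) 1, d ξ ≠ p := fun ξ hξ h => hp (h ▸ hdΩ hξ)
  interval_cases n
  · exact absurd (Subsingleton.elim _ _) (hdp ζ hζ)
  have hnorm : ∀ x : EuclideanSpace ℂ (Fin 1), dist x p = ‖x 0 - p 0‖ := by
    intro x
    rw [EuclideanSpace.dist_eq]
    simp [dist_eq_norm]
  have hd0 : ∀ ξ ∈ closedBall (0 : ℂ) 1, d ξ 0 - p 0 ≠ 0 := fun ξ hξ h => by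
    refine hdp ξ hξ (dist_eq_zero.1 ?_)
    rw [hnorm, h, norm_zero]
  have hd' : DiffContOnCl ℂ (fun ξ => (d ξ 0 - p 0)⁻¹) (ball 0 1) := by
    refine DiffContOnCl.inv ⟨?_, ?_⟩ ?_
    · exact ((differentiableOn_euclidean.1 hdd) 0).sub_const _
    · rw [closure_ball _ one_ne_zero]
      exact ((PiLp.continuous_apply 2 _ 0).comp_continuousOn hdc).sub continuousOn_const
    · rwa [closure_ball _ one_ne_zero]
  have hmax := Complex.norm_le_of_forall_mem_frontier_norm_le isBounded_ball hd' (C := m⁻¹)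
    (fun ξ hξ => by
      rw [frontier_ball _ one_ne_zero] at hξ
      rw [norm_inv, ← hnorm]
      exact inv_anti₀ hm0 ((le_infDist hne).1 (hm ξ hξ) hp))
    (z := ζ) (by rwa [closure_ball _ one_ne_zero])
  rw [norm_inv, inv_le_inv₀ (norm_pos_iff.2 (hd0 ζ hζ)) hm0] at hmax
  rwa [hnorm]

/-! ### From the minimum principle to the Kontinuitätssatz -/

theorem IsAnalyticDisc.norm_le {n : ℕ} {Ω : Set (EuclideanSpace ℂ (Fin n))}
    {d : ℂ → EuclideanSpace ℂ (Fin n)} (hd : IsAnalyticDisc Ω d) {R : ℝ}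
    (hR : ∀ ζ ∈ sphere (0 : ℂ) 1, ‖d ζ‖ ≤ R) : ∀ ζ ∈ closedBall (0 : ℂ) 1, ‖d ζ‖ ≤ R := by
  intro ζ hζ
  refine Complex.norm_le_of_forall_mem_frontier_norm_le (U := ball (0 : ℂ) 1) isBounded_ball
    ⟨hd.2.1, ?_⟩ ?_ ?_
  · rw [closure_ball _ one_ne_zero]
    exact hd.1
  · rwa [frontier_ball _ one_ne_zero]
  · rwa [closure_ball _ one_ne_zero]

theorem isPseudoconvex_of_slice {n : ℕ} {Ω : Set (EuclideanSpace ℂ (Fin n))} (hΩ : IsOpen Ω)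
    (hs : ∀ a b c : EuclideanSpace ℂ (Fin n), LinearIndependent ℂ ![b, c] →
      IsPseudoconvex (slice a b c Ω)) : IsPseudoconvex Ω := by
  refine ⟨hΩ, ?_⟩
  rintro 𝒟 h𝒟 ⟨K, hKΩ, hK, h𝒟K⟩
  obtain ⟨R, hR⟩ := hK.isBounded.subset_closedBall 0
  have hbound : ∀ d ∈ 𝒟, d '' closedBall 0 1 ⊆ closedBall 0 R := by
    rintro d hd _ ⟨ζ, hζ, rfl⟩
    rw [mem_closedBall_zero_iff]
    refine (h𝒟 d hd).norm_le (fun ξ hξ => ?_) ζ hζ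
    exact mem_closedBall_zero_iff.1 (hR (h𝒟K d hd ⟨ξ, hξ, rfl⟩))
  rcases Ωᶜ.eq_empty_or_nonempty with hΩe | hne
  · rw [Set.compl_empty_iff] at hΩe
    exact ⟨closedBall 0 R, hΩe ▸ Set.subset_univ _, isCompact_closedBall _ _, hbound⟩
  obtain ⟨m, hm0, hm⟩ := hK.exists_thickening_subset_open hΩ hKΩ
  have hmK : ∀ x ∈ K, m ≤ infDist x Ωᶜ := by
    intro x hx
    rw [le_infDist hne]
    intro p hp
    by_contra! hlt
    exact hp (hm (mem_thickening_iff.2 ⟨x, hx, by rwa [dist_comm]⟩))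
  refine ⟨closedBall 0 R ∩ {x | m ≤ infDist x Ωᶜ}, ?_,
    (isCompact_closedBall _ _).inter_right
      (isClosed_le continuous_const (continuous_infDist_pt _)), ?_⟩
  · rintro x ⟨-, hx⟩
    by_contra h
    have : infDist x Ωᶜ = 0 := infDist_zero_of_mem h
    rw [Set.mem_ofPred_eq, this] at hx
    linarith
  · intro d hd
    refine Set.subset_inter (hbound d hd) ?_
    rintro _ ⟨ζ, hζ, rfl⟩
    have hsph : ∀ ξ ∈ sphere (0 : ℂ) 1, m ≤ infDist (d ξ) Ωᶜ :=
      fun ξ hξ => hmK _ (h𝒟K d hd ⟨ξ, hξ, rfl⟩)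
    rcases lt_or_ge n 2 with hn | hn
    · exact le_infDist_compl_of_sphere_of_lt_two hn hne (h𝒟 d hd) hm0 hsph ζ hζ
    · exact le_infDist_compl_of_sphere_of_two_le hn hΩ hne hs (h𝒟 d hd) hsph ζ hζ

theorem theorem1 (n : ℕ) (Ω : Set (EuclideanSpace ℂ (Fin n))) (hΩ : IsOpen Ω) :
    IsPseudoconvex Ω ↔
      ∀ a b c : EuclideanSpace ℂ (Fin n), LinearIndependent ℂ ![b, c] →
        IsPseudoconvex (slice a b c Ω) :=
  ⟨fun h a _ _ hli => h.slice a hli, isPseudoconvex_of_slice hΩ⟩
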